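/- Let $X$ be a nonsingular projective (integral) curve over a finite field $\mathbb{F}_q$, let $\infty$ be a closed point of $X$, let $A$ be the ring of regular functions on $X\setminus\{\infty\}$, and let $K$ be the fraction field of $A$, i.e. the function field of $X$. For a field extension $L$ of $K$, a Drinfeld $A$-module over $L$ is an $\mathbb{F}_q$-algebra homomorphism $a\mapsto\phi_a$ from $A$ to the ring of $\mathbb{F}_q$-linear polynomials $\sum_i c_i x^{q^i}\in L[x]$ (with composition as multiplication) such that $\phi_a(x)=ax+(\text{higher powers of }x)$ for all $a\in A$, and $\phi_a(x)\neq ax$ for some $a$. It has rank $r$ if $\deg_x\phi_a=\#(A/aA)^r$ for all nonzero $a\in A$. Put $$({}^\phi L)_{\mathrm{tors}}=\{\alpha\in L \mid \phi_a(\alpha)=0\text{ for some nonzero }a\in A\}.$$ Theorem. For every such $A$ and every integer $d\ge 1$ there is a constant $C$, depending only on $A$ and $d$, such that $$\#({}^\phi L)_{\mathrm{tors}}\le C$$ for every field extension $L$ of $K$ with $[L:K]\le d$ and every Drinfeld $A$-module $\phi$ of rank $1$ over $L$. -/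

import Mathlib

universe u v w

open Polynomial

/-- `K` is the function field of an integral curve over `k`:
a finitely generated field extension of `k` of transcendence degree one. -/
structure IsCurveFunctionField (k K : Type*) [Field k] [Field K] [Algebra k K] : Prop where
  fg : (⊤ : IntermediateField k K).FG
  trdeg_eq_one : Algebra.trdeg k K = 1

/-- A closed point of the nonsingular projective curve over `k` with function field `K`, given by
its local ring: a valuation ring of `K` containing `k` and different from `K` itself. -/
@[ext]
structure CurvePoint (k K : Type*) [Field k] [Field K] [Algebra k K] where
  /-- The local ring at the point, as a subring of the function field. -/
  localRing : ValuationSubring K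
  algebraMap_mem : ∀ c : k, algebraMap k K c ∈ localRing
  ne_top : localRing ≠ ⊤

/-- The ring `A` of regular functions on the affine curve obtained by deleting the closed point
`infty`: the rational functions that lie in the local ring of every other closed point. -/
def regularFunctions {k K : Type*} [Field k] [Field K] [Algebra k K] (infty : CurvePoint k K) :
    Subalgebra k K where
  carrier := {f | ∀ P : CurvePoint k K, P ≠ infty → f ∈ P.localRing}
  mul_mem' hf hg P hP := mul_mem (hf P hP) (hg P hP)
  add_mem' hf hg P hP := add_mem (hf P hP) (hg P hP)
  algebraMap_mem' c P _ := P.algebraMap_mem c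

/-- A Drinfeld `A`-module over an extension field `L` of `K`, where `A = regularFunctions infty` and
the structure map `A → L` is the inclusion. With `q = #k`, it is a `k`-algebra homomorphism
`a ↦ φ_a` from `A` to the ring of polynomials `∑ cᵢ X ^ (q ^ i)` over `L` (with multiplication given
by composition), such that `φ_a` has linear term `a X` for all `a`, and such that `φ_a ≠ a X`
for some `a`. -/
structure DrinfeldModule {k K : Type*} [Field k] [Field K] [Algebra k K] (infty : CurvePoint k K)
    (L : Type*) [Field L] [Algebra K L] where
  /-- The polynomial `φ_a`. -/
  poly : regularFunctions infty → L[X]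
  exists_eq_of_coeff_ne_zero :
    ∀ a n, (poly a).coeff n ≠ 0 → ∃ i : ℕ, n = Nat.card k ^ i
  map_add : ∀ a b, poly (a + b) = poly a + poly b
  map_mul : ∀ a b, poly (a * b) = (poly a).comp (poly b)
  map_algebraMap : ∀ c : k, poly (algebraMap k (regularFunctions infty) c) =
    C (algebraMap K L (algebraMap k K c)) * X
  coeff_one : ∀ a, (poly a).coeff 1 = algebraMap K L (a : K)
  exists_ne : ∃ a, poly a ≠ C (algebraMap K L (a : K)) * X

namespace DrinfeldModule

variable {k K : Type*} [Field k] [Field K] [Algebra k K] {infty : CurvePoint k K}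
  {L : Type*} [Field L] [Algebra K L]

/-- `φ` has rank `r`: the degree of `φ_a` in `X` is `#(A / aA) ^ r` for all nonzero `a`.
(Equivalently, the degree of `φ_a` in the `q`-Frobenius is `r * deg a`, where
`q ^ deg a = #(A / aA)`.) -/
def HasRank (φ : DrinfeldModule infty L) (r : ℕ) : Prop :=
  ∀ a : regularFunctions infty, a ≠ 0 →
    (φ.poly a).natDegree = Nat.card (regularFunctions infty ⧸ Ideal.span {a}) ^ r

/-- The torsion submodule of `L`, on which `a` in `A` acts by `α ↦ φ_a(α)`, as a subset of `L`. -/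
def torsion (φ : DrinfeldModule infty L) : Set L :=
  {α | ∃ a : regularFunctions infty, a ≠ 0 ∧ (φ.poly a).eval α = 0}

end DrinfeldModule

/-! Fix $t\in A$ with $\#(A/tA)>1$; for every rank one $\phi$ this number is $\deg\phi_t$. Choose a
valuation ring $O$ of $\bar L$ containing $A$ and having $t$ in its maximal ideal. In rank one, some
rescaling $u^{-1}\phi_a(uX)$ has coefficients in $O$ and unit leading coefficients
(`IsLinearAction.exists_good_reduction`). Indeed, normalise so that the reduction is defined and
nontrivial. A nontrivial action over any field has rank at least one
(`IsLinearAction.card_quotient_le_natDegree`), so its degrees cannot drop. Rescaled torsion points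
are then integral, and two that agree modulo $t^2O$ are equal: on $t^2O$ the action of $t$ is
multiplication by $t$ times a unit, while a torsion orbit is eventually periodic
(`IsLinearAction.eq_zero_of_dvd_of_eval_eq_zero`). Finally, the $k[t]$-span $W$ of finitely many
torsion points, under ordinary multiplication, is free of rank at most $[L:k(t)]$. The points inject
into $W/t^2W$, so there are at most $q^{2[K:k(t)]d}$ of them. -/

/-! ### Formal linear actions and their degrees -/

/-- `ψ` turns elements of `A` into polynomials `∑ cᵢ X ^ (q ^ i)` over `R`, respecting addition and
turning multiplication into composition. -/
structure IsLinearAction (q : ℕ) {A R : Type*} [CommRing A] [CommRing R] (ψ : A → R[X]) :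
    Prop where
  exists_eq_of_coeff_ne_zero : ∀ a n, (ψ a).coeff n ≠ 0 → ∃ i : ℕ, n = q ^ i
  map_add : ∀ a b, ψ (a + b) = ψ a + ψ b
  map_mul : ∀ a b, ψ (a * b) = (ψ a).comp (ψ b)
  map_one : ψ 1 = X

theorem exists_lt_dvd_pow_sub_pow {A : Type*} [CommRing A] (a b : A)
    [Finite (A ⧸ Ideal.span {b})] : ∃ n m : ℕ, n < m ∧ b ∣ a ^ m - a ^ n := by
  obtain ⟨n, m, hne, h⟩ := Finite.exists_ne_map_eq_of_infinite
    fun n : ℕ => Ideal.Quotient.mk (Ideal.span {b}) (a ^ n)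
  wlog hlt : n < m generalizing n m
  · exact this m n hne.symm h.symm (lt_of_le_of_ne (not_lt.mp hlt) hne.symm)
  exact ⟨n, m, hlt, Ideal.mem_span_singleton.mp (Ideal.Quotient.eq.mp h.symm)⟩

/-- The set may be infinite, so the gcd is taken as a generator of the ideal it spans in
$\mathbb{Z}$. -/
theorem exists_gcd_of_set (G : Set ℕ) :
    ∃ e : ℕ, (∀ m ∈ G, e ∣ m) ∧ ∀ p : ℕ, (∀ m ∈ G, p ∣ m) → p ∣ e := by
  let I : Ideal ℤ := Ideal.span ((fun m : ℕ => (m : ℤ)) '' G)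
  obtain ⟨g, hg⟩ := (IsPrincipalIdealRing.principal I).principal
  rw [← Ideal.span] at hg
  refine ⟨g.natAbs, fun m hm => ?_, fun p hp => ?_⟩
  · have h : (m : ℤ) ∈ I := Ideal.subset_span ⟨m, hm, rfl⟩
    rw [hg, Ideal.mem_span_singleton] at h
    simpa using Int.natAbs_dvd_natAbs.mpr h
  · have h : I ≤ Ideal.span {(p : ℤ)} := by
      refine Ideal.span_le.mpr ?_
      rintro _ ⟨m, hm, rfl⟩
      exact Ideal.mem_span_singleton.mpr (Int.natCast_dvd_natCast.mpr (hp m hm))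
    rw [hg, Ideal.span_singleton_le_span_singleton] at h
    simpa using Int.natAbs_dvd_natAbs.mpr h

namespace IsLinearAction

section CommRing

variable {q : ℕ} {A R : Type*} [CommRing A] [CommRing R] {ψ : A → R[X]}

theorem map_zero (h : IsLinearAction q ψ) : ψ 0 = 0 := by
  simpa using h.map_add 0 0

theorem map_neg (h : IsLinearAction q ψ) (a : A) : ψ (-a) = -ψ a := by
  rw [eq_neg_iff_add_eq_zero, ← h.map_add, neg_add_cancel, h.map_zero]

theorem map_sub (h : IsLinearAction q ψ) (a b : A) : ψ (a - b) = ψ a - ψ b := by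
  rw [sub_eq_add_neg, h.map_add, h.map_neg, sub_eq_add_neg]

theorem natDegree_eq (h : IsLinearAction q ψ) {a : A} (ha : ψ a ≠ 0) :
    ∃ i : ℕ, (ψ a).natDegree = q ^ i :=
  h.exists_eq_of_coeff_ne_zero a _ (leadingCoeff_ne_zero.mpr ha)

theorem comp_comm (h : IsLinearAction q ψ) (a b : A) :
    (ψ a).comp (ψ b) = (ψ b).comp (ψ a) := by
  rw [← h.map_mul, mul_comm, h.map_mul]

theorem coeff_zero (h : IsLinearAction q ψ) (hq : 1 < q) (a : A) : (ψ a).coeff 0 = 0 := by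
  by_contra h0
  obtain ⟨i, hi⟩ := h.exists_eq_of_coeff_ne_zero a 0 h0
  exact (pow_pos (by omega) i).ne hi

theorem natDegree_pos (h : IsLinearAction q ψ) (hq : 1 < q) {a : A} (ha : ψ a ≠ 0) :
    0 < (ψ a).natDegree := by
  obtain ⟨i, hi⟩ := h.natDegree_eq ha
  rw [hi]
  positivity

end CommRing

variable {q : ℕ} {A κ : Type*} [CommRing A] [Field κ] {ψ : A → κ[X]}

theorem natDegree_mul (h : IsLinearAction q ψ) (a b : A) :
    (ψ (a * b)).natDegree = (ψ a).natDegree * (ψ b).natDegree := by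
  rw [h.map_mul, natDegree_comp]

theorem natDegree_pow (h : IsLinearAction q ψ) (a : A) (n : ℕ) :
    (ψ (a ^ n)).natDegree = (ψ a).natDegree ^ n := by
  induction n with
  | zero => simp [h.map_one]
  | succ n ih => rw [pow_succ, h.natDegree_mul, ih, pow_succ]

/-- By pigeonhole in $A/bA$, $b$ divides some $a^m-a^n$ with $n<m$. If $\psi_b=0$, then
$\psi_{a^m}=\psi_{a^n}$, contradicting multiplicativity of degrees when $\deg\psi_a>1$. -/
theorem eq_zero_of_map_eq_zero [NoZeroDivisors A]
    (h : IsLinearAction q ψ) (hne : ∃ a, 1 < (ψ a).natDegree)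
    (hfin : ∀ b : A, b ≠ 0 → Finite (A ⧸ Ideal.span {b})) {b : A} (hb : ψ b = 0) : b = 0 := by
  by_contra hb0
  obtain ⟨a, ha⟩ := hne
  have := hfin b hb0
  obtain ⟨n, m, hnm, c, hc⟩ := exists_lt_dvd_pow_sub_pow a b
  have h1 : ψ (a ^ m) = ψ (a ^ n) := by
    rw [← sub_eq_zero, ← h.map_sub, hc, h.map_mul, hb, zero_comp]
  have h2 := congrArg natDegree h1
  rw [h.natDegree_pow, h.natDegree_pow] at h2
  exact hnm.ne' (Nat.pow_right_injective ha h2)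

/-! ### Counting elements of bounded degree; rank at least one -/

/-- Compare leading coefficients in $\psi_a\circ\psi_x=\psi_x\circ\psi_a$ for $x=b$ and $x=c$, and
divide. This confines the leading coefficients in a given degree to finitely many multiples of one
of them, although the field may be infinite. -/
theorem leadingCoeff_div_pow (h : IsLinearAction q ψ) (hq : 1 < q) {a b c : A} (ha : ψ a ≠ 0)
    (hb : ψ b ≠ 0) (hc : ψ c ≠ 0) (hbc : (ψ b).natDegree = (ψ c).natDegree) :
    ((ψ b).leadingCoeff / (ψ c).leadingCoeff) ^ (ψ a).natDegree =
      (ψ b).leadingCoeff / (ψ c).leadingCoeff := by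
  have key : ∀ x, ψ x ≠ 0 → (ψ x).leadingCoeff * (ψ a).leadingCoeff ^ (ψ x).natDegree =
      (ψ a).leadingCoeff * (ψ x).leadingCoeff ^ (ψ a).natDegree := fun x hx => by
    rw [← leadingCoeff_comp (h.natDegree_pos hq ha).ne',
      ← leadingCoeff_comp (h.natDegree_pos hq hx).ne', h.comp_comm]
  have h1 := key b hb
  have h2 := key c hc
  rw [hbc] at h1
  have hla := leadingCoeff_ne_zero.mpr ha
  have hlc := leadingCoeff_ne_zero.mpr hc
  rw [div_pow, div_eq_div_iff (pow_ne_zero _ hlc) hlc]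
  apply mul_left_cancel₀ (mul_ne_zero hla (pow_ne_zero (ψ c).natDegree hla))
  linear_combination (-(ψ a).leadingCoeff ^ (ψ c).natDegree * (ψ c).leadingCoeff) * h1 +
    ((ψ a).leadingCoeff ^ (ψ c).natDegree * (ψ b).leadingCoeff) * h2

theorem card_pow_eq_self_le (Q : ℕ) (hQ : 1 < Q) (s : Finset κ) (hs : ∀ x ∈ s, x ^ Q = x) :
    s.card ≤ Q := by
  classical
  have h0 : (X ^ Q - X : κ[X]) ≠ 0 := FiniteField.X_pow_card_sub_X_ne_zero κ hQ
  have hsub : s ⊆ (X ^ Q - X : κ[X]).roots.toFinset := fun x hx => by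
    simp [h0, hs x hx]
  calc s.card ≤ _ := Finset.card_le_card hsub
    _ ≤ _ := Multiset.toFinset_card_le _
    _ ≤ _ := card_roots' _
    _ = Q := FiniteField.X_pow_card_sub_X_natDegree_eq κ hQ

/-- The number of `b` with `deg ψ_b < H` grows at most linearly with `H`. -/
theorem exists_card_le (h : IsLinearAction q ψ) (hq : 1 < q)
    (hinj : ∀ b, ψ b = 0 → b = 0) (hne : ∃ a, 1 < (ψ a).natDegree) :
    ∃ C : ℕ, ∀ H : ℕ, ∀ s : Finset A, (∀ b ∈ s, (ψ b).natDegree < H) → s.card ≤ C * H := by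
  classical
  -- All degrees are powers of $Q=q^e$, where $e$ is the gcd of the exponents that occur.
  obtain ⟨e, he, he'⟩ := exists_gcd_of_set {m | ∃ a, ψ a ≠ 0 ∧ (ψ a).natDegree = q ^ m}
  have hepos : e ≠ 0 := by
    rintro rfl
    obtain ⟨a, ha⟩ := hne
    have ha0 : ψ a ≠ 0 := by rintro h0; simp [h0] at ha
    obtain ⟨m, hm⟩ := h.natDegree_eq ha0
    have := he m ⟨a, ha0, hm⟩
    rw [zero_dvd_iff.mp this] at hm
    simp [hm] at ha
  have hQ : 1 < q ^ e := Nat.one_lt_pow hepos hq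
  have hdeg : ∀ b, ψ b ≠ 0 → ∃ j, (ψ b).natDegree = (q ^ e) ^ j := fun b hb => by
    obtain ⟨m, hm⟩ := h.natDegree_eq hb
    obtain ⟨j, rfl⟩ := he m ⟨b, hb, hm⟩
    exact ⟨j, by rw [hm, pow_mul]⟩
  have hfix : ∀ b c, ψ b ≠ 0 → ψ c ≠ 0 → (ψ b).natDegree = (ψ c).natDegree →
      ((ψ b).leadingCoeff / (ψ c).leadingCoeff) ^ q ^ e =
        (ψ b).leadingCoeff / (ψ c).leadingCoeff := fun b c hb hc hbc => by
    set x := (ψ b).leadingCoeff / (ψ c).leadingCoeff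
    -- The period of the ratio under $y\mapsto y^q$ divides every exponent $m$ that occurs, hence
    -- divides $e$.
    have hd : Function.minimalPeriod (fun y : κ => y ^ q) x ∣ e := by
      refine he' _ ?_
      rintro m ⟨a, ha, hm⟩
      apply Function.IsPeriodicPt.minimalPeriod_dvd
      change (fun y : κ => y ^ q)^[m] x = x
      rw [pow_iterate, ← hm]
      exact h.leadingCoeff_div_pow hq ha hb hc hbc
    have := Function.isPeriodicPt_iff_minimalPeriod_dvd.mpr hd
    change (fun y : κ => y ^ q)^[e] x = x at this
    rwa [pow_iterate] at this
  have main : ∀ i : ℕ, ∀ s : Finset A, (∀ b ∈ s, (ψ b).natDegree < (q ^ e) ^ i) →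
      s.card ≤ (q ^ e) ^ i := by
    intro i
    induction i with
    | zero =>
      intro s hs
      rw [pow_zero]
      refine Finset.card_le_one.mpr fun a ha b hb => ?_
      have h0 : ∀ c ∈ s, c = 0 := fun c hc => by
        apply hinj
        by_contra hc0
        have := h.natDegree_pos hq hc0
        have := hs c hc
        rw [pow_zero] at this
        omega
      rw [h0 a ha, h0 b hb]
    | succ i ih =>
      intro s hs
      have hle : ∀ b ∈ s, (ψ b).natDegree ≤ (q ^ e) ^ i := fun b hb => by
        by_cases hb0 : ψ b = 0
        · simp [hb0]
        obtain ⟨j, hj⟩ := hdeg b hb0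
        have := hs b hb
        rw [hj] at this ⊢
        have := (Nat.pow_lt_pow_iff_right hQ).mp this
        exact Nat.pow_le_pow_right (by omega) (by omega)
      by_cases hex : ∃ c, (ψ c).natDegree = (q ^ e) ^ i
      · obtain ⟨c, hc⟩ := hex
        have hc0 : ψ c ≠ 0 := by
          intro h0
          rw [h0, natDegree_zero] at hc
          exact absurd hc.symm (by positivity)
        -- The normalised coefficient in degree $Q^i$ satisfies $x^Q=x$, so it takes at most $Q$
        -- values. Elements sharing a value differ by an element of degree below $Q^i$, so each
        -- fibre is controlled by induction.
        let f : A → κ := fun b => (ψ b).coeff ((q ^ e) ^ i) / (ψ c).leadingCoeff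
        have himg : (s.image f).card ≤ q ^ e := by
          refine card_pow_eq_self_le _ hQ _ fun x hx => ?_
          obtain ⟨b, hb, rfl⟩ := Finset.mem_image.mp hx
          rcases (hle b hb).lt_or_eq with hlt | heq
          · have : f b = 0 := by simp [f, coeff_eq_zero_of_natDegree_lt hlt]
            rw [this, zero_pow (by positivity)]
          · have hb0 : ψ b ≠ 0 := by
              intro h0
              rw [h0, natDegree_zero] at heq
              exact absurd heq.symm (by positivity)
            have := hfix b c hb0 hc0 (by rw [heq, hc])
            simpa [f, ← heq] using this
        calc s.card ≤ (q ^ e) ^ i * (s.image f).card := by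
              refine Finset.card_le_mul_card_image s _ fun x hx => ?_
              obtain ⟨b, hb, rfl⟩ := Finset.mem_image.mp hx
              rw [← Finset.card_image_of_injective _ (sub_left_injective (b := b))]
              refine ih _ fun y hy => ?_
              obtain ⟨d, hd, rfl⟩ := Finset.mem_image.mp hy
              rw [Finset.mem_filter] at hd
              have hcoeff : (ψ d).coeff ((q ^ e) ^ i) = (ψ b).coeff ((q ^ e) ^ i) := by
                have := hd.2
                simp only [f] at this
                exact (div_left_inj' (leadingCoeff_ne_zero.mpr hc0)).mp this
              simp only [h.map_sub]
              have hle' : (ψ d - ψ b).natDegree ≤ (q ^ e) ^ i :=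
                (natDegree_sub_le _ _).trans (max_le (hle d hd.1) (hle b hb))
              refine lt_of_le_of_ne hle' fun heq => ?_
              have hz : (ψ d - ψ b).leadingCoeff = 0 := by
                rw [leadingCoeff, heq, coeff_sub, hcoeff, sub_self]
              rw [leadingCoeff_eq_zero.mp hz, natDegree_zero] at heq
              exact absurd heq.symm (by positivity)
          _ ≤ (q ^ e) ^ i * q ^ e := Nat.mul_le_mul_left _ himg
          _ = _ := (pow_succ _ _).symm
      · refine (ih s fun b hb => lt_of_le_of_ne (hle b hb) fun heq => hex ⟨b, heq⟩).trans ?_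
        exact Nat.pow_le_pow_right (by omega) (by omega)
  refine ⟨q ^ e, fun H s hs => ?_⟩
  rcases Nat.eq_zero_or_pos H with rfl | hH
  · have : s = ∅ := Finset.eq_empty_of_forall_notMem fun b hb => by simpa using hs b hb
    simp [this]
  obtain ⟨n, hn, hn'⟩ := exists_nat_pow_near hH hQ
  calc s.card ≤ (q ^ e) ^ (n + 1) := main _ s fun b hb => (hs b hb).trans hn'
    _ = q ^ e * (q ^ e) ^ n := pow_succ' _ _
    _ ≤ _ := Nat.mul_le_mul_left _ hn

/-- The rank of `ψ` is at least one: the index of `bA` is at most the degree of `ψ_b`. -/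
theorem card_quotient_le_natDegree [IsDomain A] (h : IsLinearAction q ψ) (hq : 1 < q)
    (hne : ∃ a, 1 < (ψ a).natDegree)
    (hfin : ∀ b : A, b ≠ 0 → Finite (A ⧸ Ideal.span {b})) {b : A} (hb : b ≠ 0) :
    Nat.card (A ⧸ Ideal.span {b}) ≤ (ψ b).natDegree := by
  classical
  have hinj : ∀ b, ψ b = 0 → b = 0 := fun b => h.eq_zero_of_map_eq_zero hne hfin
  obtain ⟨C, hC⟩ := h.exists_card_le hq hinj hne
  have := hfin b hb
  have := Fintype.ofFinite (A ⧸ Ideal.span {b})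
  have hsurj := Ideal.Quotient.mk_surjective (I := Ideal.span {b})
  let S : Finset A := Finset.univ.image (Function.surjInv hsurj)
  have hS : S.card = Nat.card (A ⧸ Ideal.span {b}) := by
    rw [Finset.card_image_of_injective _ (Function.injective_surjInv hsurj), Finset.card_univ,
      Nat.card_eq_fintype_card]
  have hSinj : ∀ s ∈ S, ∀ s' ∈ S, b ∣ s - s' → s = s' := by
    intro s hs s' hs' hd
    obtain ⟨x, -, rfl⟩ := Finset.mem_image.mp hs
    obtain ⟨y, -, rfl⟩ := Finset.mem_image.mp hs'
    have := Ideal.Quotient.eq.mpr (Ideal.mem_span_singleton.mpr hd)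
    rw [Function.surjInv_eq hsurj, Function.surjInv_eq hsurj] at this
    rw [this]
  set N := Nat.card (A ⧸ Ideal.span {b})
  set M := (ψ b).natDegree
  have hM : 0 < M := h.natDegree_pos hq fun h0 => hb (hinj b h0)
  set E := S.sup fun s => (ψ s).natDegree
  -- $V$ consists of the expansions with $n$ base-$b$ digits in $S$: they are $N^n$ distinct
  -- elements whose degrees grow only like $M^n$.
  have hV : ∀ n : ℕ, ∃ V : Finset A, V.card = N ^ n ∧ ∀ v ∈ V, (ψ v).natDegree ≤ E * M ^ n := by
    intro n
    induction n with
    | zero => exact ⟨{0}, by simp, by simp [h.map_zero]⟩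
    | succ n ih =>
      obtain ⟨V, hV, hVd⟩ := ih
      refine ⟨Finset.image₂ (fun s v => s + b * v) S V, ?_, ?_⟩
      · rw [Finset.card_image₂_iff.mpr, hS, hV, pow_succ']
        rintro ⟨s, v⟩ hsv ⟨s', v'⟩ hsv' heq
        simp only [Set.mem_prod, Finset.mem_coe] at hsv hsv' heq
        have hs : s = s' := hSinj s hsv.1 s' hsv'.1 ⟨v' - v, by linear_combination heq⟩
        subst hs
        rw [mul_left_cancel₀ hb (add_left_cancel heq)]
      · intro v hv
        obtain ⟨s, hs, w, hw, rfl⟩ := Finset.mem_image₂.mp hv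
        rw [h.map_add]
        refine (natDegree_add_le _ _).trans (max_le ?_ ?_)
        · exact (Finset.le_sup (f := fun s => (ψ s).natDegree) hs).trans
            (Nat.le_mul_of_pos_right _ (pow_pos hM _))
        · rw [h.natDegree_mul, pow_succ]
          calc M * (ψ w).natDegree ≤ M * (E * M ^ n) := Nat.mul_le_mul_left _ (hVd w hw)
            _ = _ := by ring
  have hbound : ∀ n : ℕ, N ^ n ≤ C * (E + 1) * M ^ n := fun n => by
    obtain ⟨V, hV, hVd⟩ := hV n
    rw [← hV, mul_assoc]
    refine hC _ V fun v hv => (hVd v hv).trans_lt ?_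
    exact Nat.mul_lt_mul_of_pos_right (Nat.lt_succ_self E) (pow_pos hM n)
  -- Linear counting gives $N^n\le C(E+1)M^n$ for all $n$, which is impossible if $N>M$.
  by_contra! hlt
  have hMq : (0 : ℚ) < M := by exact_mod_cast hM
  have hr : (1 : ℚ) < N / M := by
    rw [one_lt_div hMq]
    exact_mod_cast hlt
  obtain ⟨n, hn⟩ := pow_unbounded_of_one_lt ((C * (E + 1) : ℕ) : ℚ) hr
  rw [div_pow, lt_div_iff₀ (pow_pos hMq n)] at hn
  have := hbound n
  exact absurd hn (not_lt.mpr (by exact_mod_cast this))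

end IsLinearAction

/-! ### Finite generation, descent of coefficients, twisting -/

namespace IsLinearAction

/-- Division by $t$: write $a=s+tc$ with $s$ among fixed residue representatives, of degree at most
$E$. If $\deg\psi_a>E$, then $\deg\psi_c<\deg\psi_a$, so $t$ and the finitely many elements of
degree at most $E$ generate $A$. Finiteness lets one scaling factor handle all coefficients. -/
theorem exists_finset_closure_eq_top {q : ℕ} {A κ : Type*} [CommRing A] [Field κ] {ψ : A → κ[X]}
    (h : IsLinearAction q ψ) (hq : 1 < q) (hinj : ∀ b, ψ b = 0 → b = 0) {t : A}
    (ht : 1 < (ψ t).natDegree) [Finite (A ⧸ Ideal.span {t})] :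
    ∃ G : Finset A, Subring.closure (G : Set A) = ⊤ := by
  classical
  have hsurj := Ideal.Quotient.mk_surjective (I := Ideal.span {t})
  have := Fintype.ofFinite (A ⧸ Ideal.span {t})
  set E := Finset.univ.sup fun x => (ψ (Function.surjInv hsurj x)).natDegree with hE
  have hfinite : {a | (ψ a).natDegree ≤ E}.Finite := by
    obtain ⟨C, hC⟩ := h.exists_card_le hq hinj ⟨t, ht⟩
    by_contra hinf
    obtain ⟨s, hs, hcard⟩ := Set.Infinite.exists_subset_card_eq hinf (C * (E + 1) + 1)
    have := hC (E + 1) s fun b hb => Nat.lt_succ_of_le (hs hb)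
    omega
  refine ⟨insert t hfinite.toFinset, eq_top_iff.mpr fun a _ => ?_⟩
  have hgen : ∀ a, (ψ a).natDegree ≤ E → a ∈ Subring.closure
      ((insert t hfinite.toFinset : Finset A) : Set A) := fun a ha =>
    Subring.subset_closure (by simp [ha])
  induction hn : (ψ a).natDegree using Nat.strong_induction_on generalizing a with
  | _ n ih =>
    rcases le_or_gt n E with hle | hgt
    · exact hgen a (hn ▸ hle)
    set s := Function.surjInv hsurj (Ideal.Quotient.mk _ a) with hs
    have hsE : (ψ s).natDegree ≤ E :=
      Finset.le_sup (f := fun x => (ψ (Function.surjInv hsurj x)).natDegree) (Finset.mem_univ _)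
    obtain ⟨c, hc⟩ : t ∣ a - s :=
      Ideal.mem_span_singleton.mp (Ideal.Quotient.eq.mp (Function.surjInv_eq hsurj _).symm)
    have hac : a = s + t * c := by rw [← hc]; ring
    have hcn : (ψ c).natDegree < n := by
      have h1 : (ψ t).natDegree * (ψ c).natDegree ≤ n := by
        rw [← h.natDegree_mul, ← hc, h.map_sub]
        exact (natDegree_sub_le _ _).trans (max_le hn.le (hsE.trans hgt.le))
      nlinarith
    rw [hac]
    exact add_mem (hgen s hsE) (mul_mem (Subring.subset_closure (by simp)) (ih _ hcn c trivial rfl))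

theorem map {q : ℕ} {A R S : Type*} [CommRing A] [CommRing R] [CommRing S] {ψ : A → R[X]}
    (h : IsLinearAction q ψ) (f : R →+* S) : IsLinearAction q fun a => (ψ a).map f where
  exists_eq_of_coeff_ne_zero a n hn := by
    refine h.exists_eq_of_coeff_ne_zero a n fun h0 => hn ?_
    rw [coeff_map, h0, _root_.map_zero]
  map_add a b := by rw [h.map_add, Polynomial.map_add]
  map_mul a b := by rw [h.map_mul, map_comp]
  map_one := by rw [h.map_one, map_X]

/-- Descent of an action to a subring containing the coefficients for a set of generators. -/
theorem exists_lift {q : ℕ} {A R S : Type*} [CommRing A] [CommRing R] [CommRing S] {φ : A → S[X]}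
    (h : IsLinearAction q φ) {f : R →+* S} (hf : Function.Injective f) {G : Set A}
    (hG : Subring.closure G = ⊤) (hcoeff : ∀ a ∈ G, ∀ n, (φ a).coeff n ∈ f.range) :
    ∃ ψ : A → R[X], IsLinearAction q ψ ∧ ∀ a, (ψ a).map f = φ a := by
  have key : ∀ a : A, ∃ p : R[X], p.map f = φ a := fun a => by
    have ha : a ∈ Subring.closure G := hG ▸ Subring.mem_top a
    induction ha using Subring.closure_induction with
    | mem x hx =>
      obtain ⟨p, hp⟩ := (mem_lifts (f := f) (φ x)).mp
        ((lifts_iff_coeff_lifts _).mpr fun n => hcoeff x hx n)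
      exact ⟨p, hp⟩
    | zero => exact ⟨0, by rw [Polynomial.map_zero, h.map_zero]⟩
    | one => exact ⟨X, by rw [map_X, h.map_one]⟩
    | add x y _ _ hx hy =>
      obtain ⟨p, hp⟩ := hx
      obtain ⟨r, hr⟩ := hy
      exact ⟨p + r, by rw [Polynomial.map_add, hp, hr, h.map_add]⟩
    | neg x _ hx =>
      obtain ⟨p, hp⟩ := hx
      exact ⟨-p, by rw [Polynomial.map_neg, hp, h.map_neg]⟩
    | mul x y _ _ hx hy =>
      obtain ⟨p, hp⟩ := hx
      obtain ⟨r, hr⟩ := hy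
      exact ⟨p.comp r, by rw [map_comp, hp, hr, h.map_mul]⟩
  choose ψ hψ using key
  have hinj := map_injective f hf
  refine ⟨ψ, ⟨fun a n hn => ?_, fun a b => hinj ?_, fun a b => hinj ?_, hinj ?_⟩, hψ⟩
  · refine h.exists_eq_of_coeff_ne_zero a n ?_
    rw [← hψ, coeff_map]
    exact (map_ne_zero_iff f hf).mpr hn
  · rw [Polynomial.map_add, hψ, hψ, hψ, h.map_add]
  · rw [map_comp, hψ, hψ, hψ, h.map_mul]
  · rw [hψ, map_X, h.map_one]

end IsLinearAction

namespace Polynomial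

/-- The polynomial `u⁻¹ p(u X)`. -/
noncomputable def twist {F : Type*} [Field F] (u : F) (p : F[X]) : F[X] :=
  C u⁻¹ * p.comp (C u * X)

theorem eval_twist {F : Type*} [Field F] (u : F) (p : F[X]) (x : F) :
    (p.twist u).eval x = u⁻¹ * p.eval (u * x) := by
  simp [twist]

theorem coeff_twist {F : Type*} [Field F] {u : F} (hu : u ≠ 0) (p : F[X]) (n : ℕ) :
    (p.twist u).coeff (n + 1) = p.coeff (n + 1) * u ^ n := by
  rw [twist, coeff_C_mul, comp_C_mul_X_coeff, pow_succ]
  field_simp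

theorem natDegree_twist {F : Type*} [Field F] {u : F} (hu : u ≠ 0) (p : F[X]) :
    (p.twist u).natDegree = p.natDegree := by
  rw [twist, natDegree_C_mul (inv_ne_zero hu), natDegree_comp, natDegree_C_mul_X _ hu, mul_one]

end Polynomial

theorem IsLinearAction.twist {q : ℕ} {A F : Type*} [CommRing A] [Field F] {φ : A → F[X]}
    (h : IsLinearAction q φ) {u : F} (hu : u ≠ 0) :
    IsLinearAction q fun a => (φ a).twist u where
  exists_eq_of_coeff_ne_zero a n hn := by
    refine h.exists_eq_of_coeff_ne_zero a n fun h0 => hn ?_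
    rw [Polynomial.twist, coeff_C_mul, comp_C_mul_X_coeff, h0, zero_mul, mul_zero]
  map_add a b := by rw [h.map_add, Polynomial.twist, add_comp, mul_add]; rfl
  map_mul a b := by
    have : C u * C u⁻¹ = (1 : F[X]) := by rw [← C_mul, mul_inv_cancel₀ hu, C_1]
    simp only [Polynomial.twist, h.map_mul, mul_comp, C_comp, comp_assoc, X_comp]
    rw [← mul_assoc, this, one_mul]
  map_one := by
    rw [h.map_one, Polynomial.twist, X_comp, ← mul_assoc, ← C_mul, inv_mul_cancel₀ hu, C_1, one_mul]

/-! ### Valuation rings and potentially good reduction -/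

namespace ValuationSubring

/-- For each nonzero entry $(c,n)$ take $r$ with $r^n=c^{-1}$, so that $cr^n=1$. The $r$ of least
valuation makes its own entry equal to $1$ and keeps the others integral. -/
theorem exists_scaling {F : Type*} [Field F] [IsAlgClosed F] (O : ValuationSubring F)
    (T : Finset (F × ℕ)) (hT : ∀ x ∈ T, x.2 ≠ 0) (hne : ∃ x ∈ T, x.1 ≠ 0) :
    ∃ u : F, u ≠ 0 ∧ (∀ x ∈ T, x.1 * u ^ x.2 ∈ O) ∧
      ∃ x ∈ T, O.valuation (x.1 * u ^ x.2) = 1 := by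
  classical
  have hroot : ∀ x : F × ℕ, ∃ r : F, x.2 ≠ 0 → r ^ x.2 = x.1⁻¹ := fun x => by
    by_cases hx : x.2 = 0
    · exact ⟨0, fun h => absurd hx h⟩
    obtain ⟨r, hr⟩ := IsAlgClosed.exists_pow_nat_eq x.1⁻¹ (Nat.pos_of_ne_zero hx)
    exact ⟨r, fun _ => hr⟩
  choose r hr using hroot
  obtain ⟨x₀, hx₀, hx₀'⟩ := hne
  obtain ⟨y, hy, hmin⟩ := (T.filter fun x => x.1 ≠ 0).exists_min_image
    (fun x => O.valuation (r x)) ⟨x₀, by simp [hx₀, hx₀']⟩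
  rw [Finset.mem_filter] at hy
  have hrne : ∀ x ∈ T, x.1 ≠ 0 → r x ≠ 0 := fun x hx hx0 h0 => by
    have := hr x (hT x hx)
    rw [h0, zero_pow (hT x hx)] at this
    exact inv_ne_zero hx0 this.symm
  have hcoef : ∀ x ∈ T, x.1 ≠ 0 → x.1 = (r x ^ x.2)⁻¹ := fun x hx _ => by
    rw [hr x (hT x hx), inv_inv]
  refine ⟨r y, hrne y hy.1 hy.2, fun x hx => ?_, y, hy.1, ?_⟩
  · by_cases hx0 : x.1 = 0
    · rw [hx0, zero_mul]
      exact O.zero_mem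
    rw [← O.valuation_le_one_iff, hcoef x hx hx0, _root_.map_mul, map_inv₀, _root_.map_pow,
      _root_.map_pow]
    have hpos : 0 < O.valuation (r x) ^ x.2 :=
      pow_pos (zero_lt_iff.mpr ((O.valuation.ne_zero_iff).mpr (hrne x hx hx0))) _
    rw [inv_mul_le_one₀ hpos]
    exact pow_le_pow_left₀ zero_le (hmin x (by simp [hx, hx0])) _
  · rw [hcoef y hy.1 hy.2, inv_mul_cancel₀ (pow_ne_zero _ (hrne y hy.1 hy.2)), _root_.map_one]

theorem mem_of_eval_map_eq_zero {F : Type*} [Field F] (O : ValuationSubring F) {p : O[X]}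
    (hp : IsUnit p.leadingCoeff) {α : F}
    (hα : (p.map O.subtype).eval α = 0) : α ∈ O := by
  obtain ⟨v, hv⟩ := hp
  have hint : IsIntegral O α := by
    refine ⟨C (↑v⁻¹ : O) * p, ?_, ?_⟩
    · exact monic_C_mul_of_mul_leadingCoeff_eq_one (by rw [← hv, Units.inv_mul])
    · rw [eval₂_mul]
      have : eval₂ (algebraMap O F) α p = 0 := by
        rw [← hα, eval_map]
        rfl
      rw [this, mul_zero]
  obtain ⟨y, rfl⟩ := IsIntegrallyClosed.isIntegral_iff.mp hint
  exact y.2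

end ValuationSubring

/-- Rank one actions have potentially good reduction. -/
theorem IsLinearAction.exists_good_reduction {q : ℕ} {A F : Type*} [CommRing A] [IsDomain A]
    [Field F] [IsAlgClosed F] {φ : A → F[X]} (h : IsLinearAction q φ) (hq : 1 < q)
    (hfin : ∀ b : A, b ≠ 0 → Finite (A ⧸ Ideal.span {b}))
    (hrank : ∀ b : A, b ≠ 0 → (φ b).natDegree = Nat.card (A ⧸ Ideal.span {b}))
    {t : A} (ht : 1 < (φ t).natDegree) (O : ValuationSubring F)
    (hO : ∀ a, (φ a).coeff 1 ∈ O) :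
    ∃ u : F, u ≠ 0 ∧ ∃ ψ : A → O[X], IsLinearAction q ψ ∧
      (∀ a, (ψ a).map O.subtype = (φ a).twist u) ∧ ∀ a, a ≠ 0 → IsUnit (ψ a).leadingCoeff := by
  classical
  have hinj : ∀ b, φ b = 0 → b = 0 := fun b => h.eq_zero_of_map_eq_zero ⟨t, ht⟩ hfin
  have ht0 : t ≠ 0 := by
    rintro rfl
    simp [h.map_zero] at ht
  have := hfin t ht0
  obtain ⟨G₀, hG₀⟩ := h.exists_finset_closure_eq_top hq hinj ht
  let G := insert t G₀
  have hG : Subring.closure (G : Set A) = ⊤ :=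
    eq_top_iff.mpr (hG₀ ▸ Subring.closure_mono (by simp [G]))
  -- Twisting by $u$ multiplies the coefficient of $X^n$ by $u^{n-1}$. The linear coefficients are
  -- unchanged and already integral.
  let T : Finset (F × ℕ) := G.biUnion fun a =>
    ((φ a).support.filter (1 < ·)).image fun n => ((φ a).coeff n, n - 1)
  have hT : ∀ x, x ∈ T ↔ ∃ a ∈ G, ∃ n, 0 < n ∧ (φ a).coeff (n + 1) ≠ 0 ∧
      ((φ a).coeff (n + 1), n) = x := fun x => by
    simp only [T, Finset.mem_biUnion, Finset.mem_image, Finset.mem_filter, mem_support_iff]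
    refine exists_congr fun a => and_congr_right fun _ => ⟨?_, ?_⟩
    · rintro ⟨n, ⟨h1, h2⟩, rfl⟩
      obtain ⟨n, rfl⟩ := Nat.exists_eq_add_of_lt h2
      exact ⟨n + 1, by omega, by convert h1 using 2; omega, by
        rw [show 1 + n + 1 = n + 1 + 1 by omega]; rfl⟩
    · rintro ⟨n, h1, h2, rfl⟩
      exact ⟨n + 1, ⟨h2, by omega⟩, rfl⟩
  obtain ⟨u, hu, hint, y, hy, hyu⟩ := O.exists_scaling T
    (fun x hx => by
      obtain ⟨a, -, n, hn, -, rfl⟩ := (hT x).mp hx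
      exact hn.ne')
    (by
      refine ⟨((φ t).coeff (φ t).natDegree, (φ t).natDegree - 1), (hT _).mpr
        ⟨t, by simp [G], (φ t).natDegree - 1, by omega, ?_, ?_⟩, ?_⟩
      all_goals try rw [Nat.sub_add_cancel ht.le]
      all_goals
        exact leadingCoeff_ne_zero.mpr fun h0 => ht0 (hinj t h0))
  obtain ⟨ψ, hψ, hψφ⟩ := (h.twist hu).exists_lift (f := O.subtype) (G := G)
    Subtype.val_injective hG (by
      intro a ha n
      suffices ((φ a).twist u).coeff n ∈ O from ⟨⟨_, this⟩, rfl⟩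
      rcases n with _ | _ | n
      · rw [(h.twist hu).coeff_zero hq]
        exact O.zero_mem
      · rw [coeff_twist hu, pow_zero, mul_one]
        exact hO a
      · rw [coeff_twist hu]
        by_cases h0 : (φ a).coeff (n + 1 + 1) = 0
        · rw [h0, zero_mul]
          exact O.zero_mem
        exact hint _ ((hT _).mpr ⟨a, ha, n + 1, by omega, h0, rfl⟩))
  refine ⟨u, hu, ψ, hψ, hψφ, fun b hb => ?_⟩
  have hcoeff : ∀ a n, ((ψ a).coeff n : F) = ((φ a).twist u).coeff n := fun a n => by
    rw [← hψφ, coeff_map]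
    rfl
  have hred := hψ.map (IsLocalRing.residue O)
  -- The entry scaled to a unit is a nonlinear coefficient, so it survives in the residue field and
  -- the reduction is nontrivial.
  have hne : ∃ a, 1 < ((ψ a).map (IsLocalRing.residue O)).natDegree := by
    obtain ⟨a, ha, n, hn, h0, rfl⟩ := (hT y).mp hy
    refine ⟨a, lt_of_lt_of_le (by omega : 1 < n + 1) (le_natDegree_of_ne_zero ?_)⟩
    rw [coeff_map, IsLocalRing.residue_ne_zero_iff_isUnit, O.valuation_eq_one_iff, hcoeff,
      coeff_twist hu]
    exact hyu
  have hge := hred.card_quotient_le_natDegree hq hne hfin hb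
  have hdeg : (ψ b).natDegree = (φ b).natDegree := by
    rw [← natDegree_twist hu, ← hψφ, natDegree_map_eq_of_injective Subtype.val_injective]
  -- Rank at least one for the reduction and rank exactly one for $\phi$ leave no room for the
  -- degree to drop.
  have heq : ((ψ b).map (IsLocalRing.residue O)).natDegree = (ψ b).natDegree :=
    le_antisymm natDegree_map_le (by rwa [hdeg, hrank b hb])
  rw [← IsLocalRing.residue_ne_zero_iff_isUnit, leadingCoeff, ← heq, ← coeff_map]
  refine leadingCoeff_ne_zero.mpr fun h0 => ?_
  exact hb (hred.eq_zero_of_map_eq_zero hne hfin h0)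

/-! ### Torsion points close to zero -/

namespace IsLinearAction

variable {q : ℕ} {A F : Type*} [CommRing A] [Field F] {O : ValuationSubring F} {ψ : A → O[X]}

/-- With $c$ the linear coefficient of $\psi_t$ and $\gamma=c^2\delta$, one has
$\psi_t(\gamma)=(c+d\gamma)\gamma=c(1+c\delta d)\gamma$. The bracket is a unit because $c$ lies in
the maximal ideal. The result is again divisible by $c^2$, so the step iterates. -/
theorem exists_isUnit_eval_pow (h : IsLinearAction q ψ) (hq : 1 < q) {t : A}
    (ht : ¬ IsUnit ((ψ t).coeff 1)) {β : O} (hβ : (ψ t).coeff 1 ^ 2 ∣ β) (n : ℕ) :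
    ∃ w : O, IsUnit w ∧ (ψ (t ^ n)).eval β = (ψ t).coeff 1 ^ n * w * β := by
  set c := (ψ t).coeff 1 with hc
  have hstep : ∀ γ : O, c ^ 2 ∣ γ → ∃ w : O, IsUnit w ∧ (ψ t).eval γ = c * w * γ := by
    rintro _ ⟨δ, rfl⟩
    set γ := c ^ 2 * δ
    have hp : ψ t = ((ψ t).divX.divX * X + C c) * X := by
      conv_lhs => rw [← divX_mul_X_add (ψ t), ← divX_mul_X_add (ψ t).divX, h.coeff_zero hq,
        coeff_divX]
      simp [hc]
    set d := (ψ t).divX.divX.eval γ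
    have he : (ψ t).eval γ = (d * γ + c) * γ := by
      rw [hp]
      simp [d]
    refine ⟨1 + c * (δ * d), ?_, ?_⟩
    · by_contra hnu
      have h1 : (1 + c * (δ * d)) ∈ IsLocalRing.maximalIdeal O := hnu
      have h2 : c * (δ * d) ∈ IsLocalRing.maximalIdeal O := Ideal.mul_mem_right _ _ ht
      have := Ideal.sub_mem _ h1 h2
      rw [add_sub_cancel_right] at this
      exact this isUnit_one
    · rw [he]
      simp only [γ]
      ring
  induction n with
  | zero => exact ⟨1, isUnit_one, by simp [h.map_one]⟩
  | succ n ih =>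
    obtain ⟨w, hw, hwe⟩ := ih
    obtain ⟨w', hw', hwe'⟩ := hstep (c ^ n * w * β) (hβ.mul_left _)
    refine ⟨w' * w, hw'.mul hw, ?_⟩
    rw [pow_succ', h.map_mul, eval_comp, hwe, hwe']
    ring

/-- Torsion forces $\psi_{t^m}(\beta)=\psi_{t^n}(\beta)$ for some $n<m$. For $\beta\ne0$ the two
sides are $c^m\beta$ and $c^n\beta$ up to units, which would make $c$ a unit. -/
theorem eq_zero_of_dvd_of_eval_eq_zero (h : IsLinearAction q ψ) (hq : 1 < q) {t b : A}
    [Finite (A ⧸ Ideal.span {b})] (ht : ¬ IsUnit ((ψ t).coeff 1)) (ht0 : (ψ t).coeff 1 ≠ 0)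
    {β : O} (hβ : (ψ t).coeff 1 ^ 2 ∣ β) (hb : (ψ b).eval β = 0) : β = 0 := by
  by_contra hβ0
  obtain ⟨n, m, hnm, a, ha⟩ := exists_lt_dvd_pow_sub_pow t b
  have heq : (ψ (t ^ m)).eval β = (ψ (t ^ n)).eval β := by
    rw [← sub_eq_zero, ← eval_sub, ← h.map_sub, ha, mul_comm, h.map_mul, eval_comp, hb,
      ← coeff_zero_eq_eval_zero, h.coeff_zero hq]
  obtain ⟨w, hw, hwe⟩ := h.exists_isUnit_eval_pow hq ht hβ n
  obtain ⟨v, hv, hve⟩ := h.exists_isUnit_eval_pow hq ht hβ m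
  rw [hwe, hve] at heq
  obtain ⟨l, rfl⟩ := Nat.exists_eq_add_of_lt hnm
  have h1 := mul_right_cancel₀ hβ0 heq
  rw [show n + l + 1 = n + (l + 1) by omega, pow_add, mul_assoc] at h1
  have h2 := mul_left_cancel₀ (pow_ne_zero n ht0) h1
  rw [← h2, pow_succ', mul_assoc] at hw
  exact ht (isUnit_of_mul_isUnit_left hw)

end IsLinearAction

/-! ### Counting in lattices over $k[t]$ -/

/-- The span $W$ of $S$ is finitely generated and torsion-free over a principal ideal domain, hence
free of rank at most $\dim_E V$. The last hypothesis makes $S$ inject into $W/cW$. The map `f`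
replaces $R\to R/cR$ by any map to a finite set that separates classes modulo $c$. -/
theorem Finset.card_le_pow_finrank {R E V κ : Type*} [CommRing R] [IsDomain R]
    [IsPrincipalIdealRing R] [Field E] [Algebra R E] [IsFractionRing R E] [AddCommGroup V]
    [Module R V] [Module E V] [IsScalarTower R E V] [FiniteDimensional E V] [Finite κ] {c : R}
    (f : R → κ) (hf : ∀ x y, f x = f y → c ∣ x - y) (S : Finset V)
    (hS : ∀ s ∈ S, ∀ s' ∈ S, ∀ w ∈ Submodule.span R (S : Set V), s - s' = c • w → s = s') :
    S.card ≤ Nat.card κ ^ Module.finrank E V := by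
  have : Module.IsTorsionFree R E := inferInstance
  have : Module.IsTorsionFree R V := .trans_faithfulSMul R E V
  let W := Submodule.span R (S : Set V)
  have : Module.Finite R W := Module.Finite.span_finset R S
  obtain ⟨r, b⟩ := Module.basisOfFiniteTypeTorsionFree' (R := R) (M := W)
  have hli : LinearIndependent E fun i => (b i : V) := by
    rw [← LinearIndependent.iff_fractionRing (R := R)]
    exact b.linearIndependent.map' W.subtype W.ker_subtype
  have hr : r ≤ Module.finrank E V := by simpa using hli.fintype_card_le_finrank
  have : Nonempty κ := ⟨f 0⟩
  let g : S → (Fin r → κ) := fun s i => f (b.repr ⟨s, Submodule.subset_span s.2⟩ i)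
  have hg : Function.Injective g := fun s s' h => by
    choose y hy using fun i => hf _ _ (congrFun h i)
    refine Subtype.ext (hS s s.2 s' s'.2 (∑ i, y i • b i : W) (Subtype.coe_prop _) ?_)
    have key : (⟨s, Submodule.subset_span s.2⟩ : W) - ⟨s', Submodule.subset_span s'.2⟩ =
        c • ∑ i, y i • b i := by
      apply b.repr.injective
      ext i
      rw [_root_.map_sub, Finsupp.sub_apply, hy i, map_smul, Finsupp.smul_apply, smul_eq_mul]
      congr 1
      rw [b.repr_sum_self]
    exact congrArg Subtype.val key
  calc S.card = Nat.card S := by simp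
    _ ≤ Nat.card (Fin r → κ) := Nat.card_le_card_of_injective g hg
    _ = Nat.card κ ^ r := by simp [Nat.card_fun]
    _ ≤ _ := Nat.pow_le_pow_right Nat.card_pos hr

section FunctionField

open IntermediateField IntermediateField.algebraAdjoinAdjoin

theorem IsCurveFunctionField.finiteDimensional_adjoin {k K : Type*} [Field k] [Field K]
    [Algebra k K] (hK : IsCurveFunctionField k K) {t : K} (ht : Transcendental k t) :
    FiniteDimensional k⟮t⟯ K := by
  have hb : IsTranscendenceBasis k ![t] :=
    AlgebraicIndependent.isTranscendenceBasis_of_lift_trdeg_le_of_finite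
      (algebraicIndependent_unique_type_iff.mpr (by simpa using ht))
      (by rw [hK.trdeg_eq_one]; simp)
  have halg := hb.isAlgebraic_field
  rw [Matrix.range_cons, Matrix.range_empty, Set.union_empty] at halg
  have : Algebra.EssFiniteType k K := IntermediateField.fg_top_iff.mp hK.fg
  have : Algebra.EssFiniteType k⟮t⟯ K := Algebra.EssFiniteType.of_comp k k⟮t⟯ K
  exact Algebra.finite_of_essFiniteType_of_isAlgebraic

theorem IsCurveFunctionField.card_le {k K : Type*} [Field k] [Finite k] [Field K] [Algebra k K]
    (hK : IsCurveFunctionField k K) {t : K} (ht : Transcendental k t) {L : Type*} [Field L]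
    [Algebra K L] [FiniteDimensional K L] (S : Finset L)
    (hS : ∀ s ∈ S, ∀ s' ∈ S, ∀ w ∈ Submodule.span (Algebra.adjoin k {t}) (S : Set L),
      s - s' = algebraMap K L t ^ 2 * w → s = s') :
    S.card ≤ Nat.card (k × k) ^ (Module.finrank k⟮t⟯ K * Module.finrank K L) := by
  have := hK.finiteDimensional_adjoin ht
  have : FiniteDimensional k⟮t⟯ L := FiniteDimensional.trans k⟮t⟯ K L
  let e := Polynomial.algEquivOfTranscendental k t ht
  have : IsPrincipalIdealRing (Algebra.adjoin k {t}) :=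
    IsPrincipalIdealRing.of_surjective e.toRingEquiv.toRingHom e.surjective
  have : IsScalarTower (Algebra.adjoin k {t}) k⟮t⟯ L := .of_algebraMap_eq fun _ => rfl
  rw [Module.finrank_mul_finrank]
  refine Finset.card_le_pow_finrank (R := Algebra.adjoin k {t}) (E := k⟮t⟯) (c := e X ^ 2)
    -- A class modulo $t^2$ in $k[t]$ is determined by its coefficients in degrees $0$ and $1$,
    -- whence $k\times k$.
    (fun x => ((e.symm x).coeff 0, (e.symm x).coeff 1)) (fun x y hxy => ?_) S
    fun s hs s' hs' w hw h => hS s hs s' hs' w hw ?_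
  · rw [Prod.mk.injEq] at hxy
    have hd : X ^ 2 ∣ e.symm x - e.symm y := by
      rw [X_pow_dvd_iff]
      intro d hd
      interval_cases d
      · rw [coeff_sub, hxy.1, sub_self]
      · rw [coeff_sub, hxy.2, sub_self]
    simpa using map_dvd e hd
  · rw [h, Algebra.smul_def, _root_.map_pow]
    have : ((e X : Algebra.adjoin k {t}) : K) = t := by simp [e]
    congr 2
    exact congrArg (algebraMap K L) this

end FunctionField

/-! ### The torsion bound for rank one Drinfeld modules -/

theorem exists_valuationSubring_mem_nonunits {A F : Type*} [CommRing A] [Field F] {f : A →+* F}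
    (hf : Function.Injective f) {t : A} (ht : ¬ IsUnit t) :
    ∃ O : ValuationSubring F, (∀ a, f a ∈ O) ∧ f t ∈ O.nonunits := by
  obtain ⟨O, hO, hO'⟩ := Ideal.image_subset_nonunits_valuationSubring
    (Ideal.span {f.rangeRestrict t}) (by
      rw [Ne, Ideal.span_singleton_eq_top]
      intro h
      let e := RingEquiv.ofBijective f.rangeRestrict
        ⟨fun x y h => hf (congrArg Subtype.val h), f.rangeRestrict_surjective⟩
      exact ht ((MulEquiv.isUnit_map e).mp h))
  exact ⟨O, fun a => hO ⟨a, rfl⟩, hO' ⟨_, Ideal.mem_span_singleton_self _, rfl⟩⟩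

theorem IsLinearAction.eval_sub {q : ℕ} {A R : Type*} [CommRing A] [CommRing R] {φ : A → R[X]}
    (h : IsLinearAction q φ) {p f : ℕ} [Fact p.Prime] [CharP R p] (hq : q = p ^ f) (a : A)
    (x y : R) : (φ a).eval (x - y) = (φ a).eval x - (φ a).eval y := by
  simp only [eval_eq_sum, Polynomial.sum, ← Finset.sum_sub_distrib]
  refine Finset.sum_congr rfl fun n hn => ?_
  obtain ⟨i, rfl⟩ := h.exists_eq_of_coeff_ne_zero a n (mem_support_iff.mp hn)
  rw [hq, ← pow_mul, sub_pow_char_pow, mul_sub]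

namespace DrinfeldModule

variable {k K : Type*} [Field k] [Field K] [Algebra k K] {infty : CurvePoint k K}
  {L : Type*} [Field L] [Algebra K L]

theorem isLinearAction (φ : DrinfeldModule infty L) : IsLinearAction (Nat.card k) φ.poly where
  exists_eq_of_coeff_ne_zero := φ.exists_eq_of_coeff_ne_zero
  map_add := φ.map_add
  map_mul := φ.map_mul
  map_one := by simpa using φ.map_algebraMap 1

theorem natDegree_pos (φ : DrinfeldModule infty L) {a : regularFunctions infty} (ha : a ≠ 0) :
    0 < (φ.poly a).natDegree := by
  refine lt_of_lt_of_le one_pos (le_natDegree_of_ne_zero ?_)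
  rw [φ.coeff_one]
  simpa using ha

theorem HasRank.finite_quotient {φ : DrinfeldModule infty L} (h : φ.HasRank 1)
    {a : regularFunctions infty} (ha : a ≠ 0) :
    Finite (regularFunctions infty ⧸ Ideal.span {a}) := by
  refine Nat.finite_of_card_ne_zero fun h0 => (φ.natDegree_pos ha).ne' ?_
  rw [h a ha, h0, pow_one]

theorem exists_one_lt_natDegree [Finite k] (φ : DrinfeldModule infty L) :
    ∃ a, 1 < (φ.poly a).natDegree := by
  obtain ⟨a, ha⟩ := φ.exists_ne
  refine ⟨a, not_le.mp fun hle => ha ?_⟩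
  rw [eq_X_add_C_of_natDegree_le_one hle, φ.coeff_one,
    φ.isLinearAction.coeff_zero Finite.one_lt_card, C_0, add_zero]

theorem sub_mem_torsion [Finite k] (φ : DrinfeldModule infty L) {x y : L} (hx : x ∈ φ.torsion)
    (hy : y ∈ φ.torsion) : x - y ∈ φ.torsion := by
  obtain ⟨a, ha, hax⟩ := hx
  obtain ⟨b, hb, hby⟩ := hy
  have h0 : ∀ c, (φ.poly c).eval 0 = 0 := fun c => by
    rw [← coeff_zero_eq_eval_zero, φ.isLinearAction.coeff_zero Finite.one_lt_card]
  refine ⟨a * b, mul_ne_zero ha hb, ?_⟩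
  have := Fintype.ofFinite k
  obtain ⟨p, hp⟩ := CharP.exists k
  obtain ⟨f, hprime, hcard⟩ := FiniteField.card k p
  have : Fact p.Prime := ⟨hprime⟩
  have : CharP L p := charP_of_injective_ringHom
    ((algebraMap K L).comp (algebraMap k K)).injective p
  rw [φ.isLinearAction.eval_sub (Nat.card_eq_fintype_card.trans hcard), φ.map_mul, eval_comp (x := y), hby,
    h0, ← φ.map_mul, mul_comm, φ.map_mul, eval_comp, hax, h0, sub_zero]

/-- An algebraic $t$ would lie in a finite field, so two of its powers would coincide, contradicting
$\deg\phi_{t^n}=(\deg\phi_t)^n$. -/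
theorem transcendental [Finite k] (φ : DrinfeldModule infty L) {t : regularFunctions infty}
    (ht : 1 < (φ.poly t).natDegree) : Transcendental k (t : K) := by
  intro halg
  have := IntermediateField.adjoin.finiteDimensional halg.isIntegral
  have : Finite (IntermediateField.adjoin k {(t : K)}) := Module.finite_of_finite k
  obtain ⟨n, m, hne, h⟩ := Finite.exists_ne_map_eq_of_infinite
    fun n : ℕ => (IntermediateField.AdjoinSimple.gen k (t : K)) ^ n
  have hpow : t ^ n = t ^ m := Subtype.ext (by simpa using congrArg Subtype.val h)
  have hdeg := congrArg (fun a => (φ.poly a).natDegree) hpow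
  simp only [φ.isLinearAction.natDegree_pow] at hdeg
  exact hne (Nat.pow_right_injective ht hdeg)

theorem HasRank.card_le_of_subset_torsion [Finite k] (hK : IsCurveFunctionField k K)
    {φ : DrinfeldModule infty L} (hφ : φ.HasRank 1) [FiniteDimensional K L]
    {t : regularFunctions infty} (ht : 1 < (φ.poly t).natDegree) (S : Finset L)
    (hS : (S : Set L) ⊆ φ.torsion) :
    S.card ≤ Nat.card (k × k) ^
      (Module.finrank (IntermediateField.adjoin k {(t : K)}) K * Module.finrank K L) := by
  have hq : 1 < Nat.card k := Finite.one_lt_card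
  let Ω := AlgebraicClosure L
  let ι : L →+* Ω := algebraMap L Ω
  let j : regularFunctions infty →+* Ω :=
    ι.comp ((algebraMap K L).comp (regularFunctions infty).val.toRingHom)
  have hj : Function.Injective j :=
    (ι.injective.comp (algebraMap K L).injective).comp Subtype.val_injective
  have hdeg : ∀ a, ((φ.poly a).map ι).natDegree = (φ.poly a).natDegree :=
    fun a => natDegree_map ι
  have ht0 : t ≠ 0 := by
    rintro rfl
    simp [φ.isLinearAction.map_zero] at ht
  have htu : ¬ IsUnit t := fun hu => by
    have h1 := hφ t ht0
    rw [Ideal.span_singleton_eq_top.mpr hu, pow_one] at h1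
    have : Subsingleton (regularFunctions infty ⧸ (⊤ : Ideal (regularFunctions infty))) :=
      Ideal.Quotient.subsingleton_iff.mpr rfl
    rw [Nat.card_of_subsingleton (0 : regularFunctions infty ⧸ ⊤)] at h1
    omega
  obtain ⟨O, hO, htO⟩ := exists_valuationSubring_mem_nonunits hj htu
  have hcoeff : ∀ a, ((φ.poly a).map ι).coeff 1 = j a := fun a => by
    rw [coeff_map, φ.coeff_one]
    rfl
  have hact : IsLinearAction (Nat.card k) fun a => (φ.poly a).map ι := φ.isLinearAction.map ι
  obtain ⟨u, hu, ψ, hψ, hψφ, hlead⟩ := hact.exists_good_reduction hq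
    (fun b hb => hφ.finite_quotient hb) (fun b hb => by rw [hdeg, hφ b hb, pow_one])
    (t := t) (by rwa [hdeg]) O (fun a => by rw [hcoeff]; exact hO a)
  have hψt : (((ψ t).coeff 1 : O) : Ω) = j t := by
    have h1 := coeff_twist hu ((φ.poly t).map ι) 0
    rw [← hψφ, coeff_map, zero_add, hcoeff, pow_zero, mul_one] at h1
    exact h1
  have heval : ∀ a x, ((ψ a).map O.subtype).eval (u⁻¹ * ι x) = u⁻¹ * ι ((φ.poly a).eval x) :=
    fun a x => by
      rw [hψφ, eval_twist, mul_inv_cancel_left₀ hu, eval_map, eval₂_at_apply]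
  have hmem : ∀ x ∈ φ.torsion, u⁻¹ * ι x ∈ O := fun x hx => by
    obtain ⟨a, ha, hax⟩ := hx
    refine O.mem_of_eval_map_eq_zero (hlead a ha) ?_
    rw [heval, hax, _root_.map_zero, mul_zero]
  refine hK.card_le (φ.transcendental ht) S fun s hs s' hs' w hw hsw => ?_
  -- Here $w$ need not be torsion, since $k[t]$ acts by ordinary multiplication. Integrality passes
  -- from $S$ to its span because $k[t]\subseteq A$ maps into $O$.
  have hwO : u⁻¹ * ι w ∈ O := by
    clear hsw
    induction hw using Submodule.span_induction with
    | mem x hx => exact hmem x (hS hx)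
    | zero => simp
    | add x y _ _ hx hy =>
      rw [_root_.map_add, mul_add]
      exact add_mem hx hy
    | smul r x _ hx =>
      have hr : (r : K) ∈ regularFunctions infty :=
        Algebra.adjoin_le (Set.singleton_subset_iff.mpr t.2) r.2
      rw [Algebra.smul_def, _root_.map_mul, mul_left_comm]
      exact mul_mem (hO ⟨r, hr⟩) hx
  obtain ⟨b, hb, hbs⟩ := φ.sub_mem_torsion (hS hs) (hS hs')
  have := hφ.finite_quotient hb
  have hβ : u⁻¹ * ι (s - s') ∈ O := hmem _ ⟨b, hb, hbs⟩
  -- The difference $s-s'$ is torsion and, after rescaling, divisible by $t^2$ in $O$.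
  have hzero := hψ.eq_zero_of_dvd_of_eval_eq_zero hq (t := t) (b := b) (β := ⟨_, hβ⟩)
    (fun hunit => by
      have h1 := O.valuation_eq_one_iff ((ψ t).coeff 1) |>.mp hunit
      rw [hψt] at h1
      exact (O.mem_nonunits_iff.mp htO).ne h1)
    (fun h0 => ht0 (hj (by rw [← hψt, h0, _root_.map_zero]; rfl)))
    ⟨⟨_, hwO⟩, Subtype.ext (by
      change u⁻¹ * ι (s - s') = (((ψ t).coeff 1 : O) : Ω) ^ 2 * (u⁻¹ * ι w)
      rw [hψt, hsw, _root_.map_mul, _root_.map_pow, mul_left_comm]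
      rfl)⟩
    (Subtype.val_injective (by
      have h1 := heval b (s - s')
      rw [hbs, _root_.map_zero, mul_zero] at h1
      exact (eval_map_apply O.subtype (p := ψ b) ⟨_, hβ⟩).symm.trans h1))
  have h1 := congrArg Subtype.val hzero
  have h2 : ι (s - s') = 0 := (mul_eq_zero.mp h1).resolve_left (inv_ne_zero hu)
  exact sub_eq_zero.mp ((map_eq_zero ι).mp h2)

end DrinfeldModule

theorem mainTheorem1 {k : Type u} [Field k] [Finite k]
    {K : Type v} [Field K] [Algebra k K] (hK : IsCurveFunctionField k K)
    (infty : CurvePoint k K) (d : ℕ) (hd : 1 ≤ d) :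
    ∃ C : ℕ, ∀ (L : Type w) [Field L] [Algebra K L],
      FiniteDimensional K L → Module.finrank K L ≤ d →
      ∀ φ : DrinfeldModule infty L, φ.HasRank 1 → φ.torsion.encard ≤ (C : ℕ∞) := by
  -- A single rank one module, if there is any, supplies $t$. The condition on $t$ amounts to
  -- $\#(A/tA)>1$, so the same $t$ serves every $L$ and $\phi$; if there is none, the bound is
  -- vacuous.
  by_cases hex : ∃ (L₀ : Type w) (_ : Field L₀) (_ : Algebra K L₀) (φ₀ : DrinfeldModule infty L₀),
      φ₀.HasRank 1
  · obtain ⟨L₀, _, _, φ₀, hφ₀⟩ := hex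
    obtain ⟨t, ht⟩ := φ₀.exists_one_lt_natDegree
    have ht0 : t ≠ 0 := by
      rintro rfl
      simp [φ₀.isLinearAction.map_zero] at ht
    set C := Nat.card (k × k) ^ (Module.finrank (IntermediateField.adjoin k {(t : K)}) K * d)
    refine ⟨C, fun L _ _ hfin hle φ hφ => ?_⟩
    have htφ : 1 < (φ.poly t).natDegree := by rwa [hφ t ht0, ← hφ₀ t ht0]
    by_contra! hlt
    obtain ⟨T, hT, hcard⟩ := Set.exists_subset_encard_eq (k := ((C + 1 : ℕ) : ℕ∞))
      (by exact_mod_cast Order.add_one_le_of_lt hlt)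
    have hTfin : T.Finite := Set.finite_of_encard_eq_coe hcard
    have h1 := hφ.card_le_of_subset_torsion hK htφ hTfin.toFinset (by simpa using hT)
    rw [hTfin.encard_eq_coe_toFinset_card] at hcard
    have h2 : hTfin.toFinset.card = C + 1 := by exact_mod_cast hcard
    have h3 := h1.trans (Nat.pow_le_pow_right Nat.card_pos (Nat.mul_le_mul_left _ hle))
    change _ ≤ C at h3
    omega
  · exact ⟨0, fun L _ _ _ _ φ hφ => absurd ⟨L, _, _, φ, hφ⟩ hex⟩
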